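/- Let $k$ be a number field of degree $d$ with ring of integers $\mathfrak{o}$, let $\Sigma=\mathrm{Hom}(k,\overline{\mathbb{Q}})$ be its set of $d$ embeddings, let $p$ be a prime number, and fix an embedding $\overline{\mathbb{Q}}\hookrightarrow\overline{\mathbb{Q}_p}$. Let $v_p$ be the additive valuation on $\overline{\mathbb{Q}_p}$ with $v_p(p)=1$ and $v_p(0)=\infty$. For a prime ideal $\mathfrak{p}\mid p$ of $\mathfrak{o}$, let $k_\mathfrak{p}$ be the completion of $k$ at $\mathfrak{p}$, let $e_\mathfrak{p}$ and $f_\mathfrak{p}$ be the ramification index and the inertia degree of $k_\mathfrak{p}/\mathbb{Q}_p$, and let $l_\mathfrak{p}$ be the maximal unramified subextension of $k_\mathfrak{p}/\mathbb{Q}_p$. Each $\sigma\in\Sigma$, viewed as an embedding $k\hookrightarrow\overline{\mathbb{Q}_p}$, extends for exactly one $\mathfrak{p}\mid p$ to a $\mathbb{Q}_p$-linear embedding $\tilde\sigma:k_\mathfrak{p}\hookrightarrow\overline{\mathbb{Q}_p}$, and $\tilde\sigma$ is unique. Let $\rho_{\mathfrak{p},1},\dotsc,\rho_{\mathfrak{p},f_\mathfrak{p}}$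 be the $\mathbb{Q}_p$-embeddings $l_\mathfrak{p}\hookrightarrow\overline{\mathbb{Q}_p}$, and let the inertial equivalence class $I_{\mathfrak{p},l}\subset\Sigma$ be the set of those $\sigma$ that extend to $k_\mathfrak{p}$ and satisfy $\tilde\sigma|_{l_\mathfrak{p}}=\rho_{\mathfrak{p},l}$. Let $\mathfrak{n}\subset\mathfrak{o}$ be a nonzero ideal, and let $m\in\{1,\dotsc,d\}$. Then for any $m$-element subsets $X\subset\mathfrak{n}$ and $S\subset\Sigma$, $$v_p\Bigl({\det}^2(\sigma(x))_{\sigma\in S,\,x\in X}\Bigr)\;\geq\;\sum_{\mathfrak{p}\mid p}\frac{1}{e_\mathfrak{p}}\sum_{l=1}^{f_\mathfrak{p}}s_{\mathfrak{p},l}\bigl(2v_\mathfrak{p}(\mathfrak{n})+s_{\mathfrak{p},l}-1\bigr),$$ where $s_{\mathfrak{p},l}=|S\cap I_{\mathfrak{p},l}|$ and $v_\mathfrak{p}(\mathfrak{n})$ is the exponent of $\mathfrak{p}$ in the prime ideal factorization of $\mathfrak{n}$. (The square of the determinant does not depend on the chosen orderings of $S$ and $X$.) -/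

import Mathlib

open NumberField IsDedekindDomain

namespace InertialDet

noncomputable section

/-! ### The `p`-adic valuation on an algebraic closure of `ℚ_p` -/

open scoped Classical in
/-- The additive valuation `v_p` on `ℚ̄_p`, normalized by `v_p(p) = 1`, with `v_p(0) = ∞`.
In terms of the `p`-adic norm on `ℚ̄_p` (for which `‖p‖ = 1/p`) one has `‖x‖ = p ^ (-v_p(x))`. -/
def vp (p : ℕ) [Fact p.Prime] : AddValuation (PadicAlgCl p) (WithTop ℝ) :=
  AddValuation.of (fun x => if x = 0 then ⊤ else ((-Real.logb p ‖x‖ : ℝ) : WithTop ℝ))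
    (by simp) (by simp)
    (by
      have hp : (1 : ℝ) < p := by exact_mod_cast (Fact.out : p.Prime).one_lt
      intro x y
      by_cases hx : x = 0
      · simp [hx]
      by_cases hy : y = 0
      · simp [hy]
      by_cases hxy : x + y = 0
      · simp [hxy]
      simp only [hx, hy, hxy, if_false]
      rw [← WithTop.coe_min, WithTop.coe_le_coe]
      have hpos : 0 < ‖x + y‖ := norm_pos_iff.mpr hxy
      rcases le_max_iff.mp (PadicAlgCl.isNonarchimedean p x y) with h | h
      · exact (min_le_left _ _).trans
          (neg_le_neg ((Real.logb_le_logb hp hpos (norm_pos_iff.mpr hx)).mpr h))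
      · exact (min_le_right _ _).trans
          (neg_le_neg ((Real.logb_le_logb hp hpos (norm_pos_iff.mpr hy)).mpr h)))
    (by
      intro x y
      by_cases hx : x = 0
      · simp [hx]
      by_cases hy : y = 0
      · simp [hy]
      simp only [hx, hy, mul_eq_zero, or_self, if_false]
      rw [← WithTop.coe_add, norm_mul, Real.logb_mul (norm_ne_zero_iff.mpr hx)
        (norm_ne_zero_iff.mpr hy), neg_add])

theorem vp_of_ne_zero (p : ℕ) [Fact p.Prime] {x : PadicAlgCl p} (hx : x ≠ 0) :
    vp p x = ((-Real.logb p ‖x‖ : ℝ) : WithTop ℝ) := by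
  simp [vp, hx]

/-! ### Primes above `p` and the completions `k_𝔭` as extensions of `ℚ_p` -/

section Completion

variable (p : ℕ) (k : Type*) [Field k] [NumberField k]

/-- The nonzero prime ideals `𝔭` of the ring of integers of `k` that lie above `p`. -/
def PrimesAbove : Type _ := {v : HeightOneSpectrum (𝓞 k) // (p : 𝓞 k) ∈ v.asIdeal}

variable {p k}

/-- The underlying prime ideal. -/
abbrev PrimesAbove.prime (P : PrimesAbove p k) : HeightOneSpectrum (𝓞 k) := P.1

/-- The completion `k_𝔭`. -/
abbrev PrimesAbove.Completion (P : PrimesAbove p k) : Type _ := P.prime.adicCompletion k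

/-- The ring of integers of `k_𝔭`. -/
abbrev PrimesAbove.Integers (P : PrimesAbove p k) : ValuationSubring P.Completion :=
  P.prime.adicCompletionIntegers k

variable [Fact p.Prime]

instance : Finite (PrimesAbove p k) := by
  have hp : Ideal.span {(p : 𝓞 k)} ≠ 0 := by
    simpa using (Fact.out : p.Prime).ne_zero
  refine Set.Finite.to_subtype (s := {v : HeightOneSpectrum (𝓞 k) | (p : 𝓞 k) ∈ v.asIdeal})
    ((Ideal.finite_factors hp).subset fun v hv => ?_)
  exact Ideal.dvd_span_singleton.mpr hv

instance : Fintype (PrimesAbove p k) := Fintype.ofFinite _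

open WithZero in
theorem PrimesAbove.valuation_le (P : PrimesAbove p k) (x : ℚ)
    (hx : Rat.padicValuation p x ≤ 1) :
    P.prime.valuation k (algebraMap ℚ k x) ≤ Rat.padicValuation p x := by
  have hpp : p.Prime := Fact.out
  have hint : ∀ c : ℤ, P.prime.valuation k (c : k) ≤ 1 := fun c => by
    simpa using P.prime.valuation_le_one (K := k) (c : 𝓞 k)
  have hpv : P.prime.valuation k (p : k) ≤ exp (-1 : ℤ) := by
    have h : P.prime.valuation k (p : k) < 1 := by
      simpa using (P.prime.valuation_lt_one_iff_mem (K := k) (p : 𝓞 k)).mpr P.2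
    rw [← exp_zero] at h
    have h0 : P.prime.valuation k (p : k) ≠ 0 := by simp [hpp.ne_zero]
    rw [← exp_log h0, exp_lt_exp] at h
    rw [← exp_log h0, exp_le_exp]
    omega
  have hunit : ∀ c : ℤ, ¬ (p : ℤ) ∣ c → P.prime.valuation k (c : k) = 1 := fun c hc => by
    have : (algebraMap (𝓞 k) k (c : 𝓞 k)) = (c : k) := by simp
    rw [← this, HeightOneSpectrum.valuation_eq_one_iff_notMem]
    intro hmem
    obtain ⟨a, b, hab⟩ :=
      (((Nat.prime_iff_prime_int.mp hpp).irreducible.coprime_iff_not_dvd).mpr hc)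
    apply P.prime.isPrime.ne_top
    rw [Ideal.eq_top_iff_one]
    have h1 : (1 : 𝓞 k) = (a : 𝓞 k) * p + b * c := by exact_mod_cast congrArg (Int.cast) hab.symm
    rw [h1]
    exact add_mem (Ideal.mul_mem_left _ _ P.2) (Ideal.mul_mem_left _ _ hmem)
  by_cases hx0 : x = 0
  · simp [hx0]
  have hden : ¬ (p : ℤ) ∣ (x.den : ℤ) := by
    have := Rat.padicValuation_le_one_iff.mp hx
    exact_mod_cast this
  have hxe : (algebraMap ℚ k x) = (x.num : k) / (x.den : ℤ) := by
    rw [eq_ratCast, Rat.cast_def]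
    simp
  have hnum0 : x.num ≠ 0 := by simpa using hx0
  obtain ⟨c, hc, hpc⟩ := (FiniteMultiplicity.of_prime_left (Nat.prime_iff_prime_int.mp hpp)
    hnum0).exists_eq_pow_mul_and_not_dvd
  set n := multiplicity (p : ℤ) x.num
  have hv : Rat.padicValuation p x = exp (-(n : ℤ)) := by
    have hxq : x = (p : ℚ) ^ n * (c : ℚ) / (x.den : ℤ) := by
      conv_lhs => rw [← Rat.num_div_den x, hc]
      push_cast
      rfl
    have hone : ∀ c : ℤ, ¬ (p : ℤ) ∣ c → Rat.padicValuation p (c : ℚ) = 1 := fun c hc => by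
      have hc0 : c ≠ 0 := by rintro rfl; simp at hc
      simp [Rat.padicValuation, hc0, padicValInt.eq_zero_of_not_dvd hc]
    rw [hxq, map_div₀, map_mul, map_pow, hone _ hpc, hone _ hden, Rat.padicValuation_self]
    simp [← exp_nsmul]
  rw [hv, hxe, map_div₀, hunit _ hden, div_one, hc]
  push_cast
  rw [map_mul, map_pow]
  calc _ ≤ (exp (-1 : ℤ)) ^ n * 1 := mul_le_mul' (pow_le_pow_left' hpv n) (hint c)
    _ = _ := by simp [← exp_nsmul]

/-- The inclusion `ℚ → k_𝔭`, with `ℚ` carrying its `p`-adic topology. -/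
def PrimesAbove.ratHom (P : PrimesAbove p k) :
    WithVal (Rat.padicValuation p) →+* P.Completion :=
  (algebraMap ℚ P.Completion).comp (WithVal.equiv (Rat.padicValuation p)).toRingHom

theorem PrimesAbove.valued_algebraMap_le (P : PrimesAbove p k) (x : ℚ)
    (hx : Rat.padicValuation p x ≤ 1) :
    Valued.v (algebraMap ℚ P.Completion x) ≤ Rat.padicValuation p x := by
  have h : algebraMap ℚ P.Completion x = ((algebraMap ℚ k x : k) : P.Completion) := by
    rw [IsScalarTower.algebraMap_apply ℚ k P.Completion,
      HeightOneSpectrum.algebraMap_adicCompletion]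
    rfl
  rw [h, HeightOneSpectrum.valuedAdicCompletion_eq_valuation']
  exact P.valuation_le x hx

open WithZero MonoidWithZeroHom.ValueGroup₀ in
theorem PrimesAbove.continuous_ratHom (P : PrimesAbove p k) : Continuous P.ratHom := by
  refine continuous_of_continuousAt_zero P.ratHom ?_
  rw [ContinuousAt, map_zero, (Valued.hasBasis_nhds_zero _ _).tendsto_iff
    (Valued.hasBasis_nhds_zero _ _)]
  rintro γ -
  set n : ℕ := (log (embedding γ.val)).natAbs
  have hn : Valued.v (R := (WithVal (Rat.padicValuation p))) (p ^ n) = exp (-n : ℤ) := by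
    simp only [← WithVal.val_apply_equiv, map_pow, map_natCast, Rat.padicValuation_self,
      ← exp_nsmul, nsmul_eq_mul, mul_neg, mul_one]
  refine ⟨Units.mk0 (Valued.v.restrict (p ^ n)) (by
    simp [Valuation.restrict_def, (Fact.out : p.Prime).ne_zero]), trivial, fun x hx => ?_⟩
  simp only [Set.mem_ofPred_eq, Units.val_mk0, Valuation.restrict_lt_iff, hn] at hx
  simp only [Set.mem_ofPred_eq, Valuation.restrict_lt_iff_lt_embedding]
  rw [← WithVal.val_apply_equiv] at hx
  have h1 : exp (-n : ℤ) ≤ (1 : ℤᵐ⁰) := by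
    rw [← exp_zero, exp_le_exp]; omega
  refine (P.valued_algebraMap_le _ (hx.le.trans h1)).trans_lt (hx.trans_le ?_)
  rw [← exp_log (embedding_unit_ne_zero γ), exp_le_exp]
  omega

/-- The canonical (continuous) embedding `ℚ_p → k_𝔭`, for `𝔭` above `p`. -/
def PrimesAbove.padicHom (P : PrimesAbove p k) : ℚ_[p] →+* P.Completion :=
  (UniformSpace.Completion.extensionHom P.ratHom P.continuous_ratHom).comp
    (Padic.withValRingEquiv (p := p)).symm.toRingHom

theorem PrimesAbove.continuous_padicHom (P : PrimesAbove p k) : Continuous P.padicHom :=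
  UniformSpace.Completion.continuous_extension.comp
    (Padic.withValUniformEquiv (p := p)).symm.continuous

/-- `k_𝔭` as an extension of `ℚ_p`. -/
instance (P : PrimesAbove p k) : Algebra ℚ_[p] P.Completion := P.padicHom.toAlgebra

theorem PrimesAbove.continuous_algebraMap (P : PrimesAbove p k) :
    Continuous (algebraMap ℚ_[p] P.Completion) := P.continuous_padicHom

instance (P : PrimesAbove p k) : ContinuousSMul ℚ_[p] P.Completion where
  continuous_smul := by
    simp only [Algebra.smul_def]
    exact (P.continuous_algebraMap.comp continuous_fst).mul continuous_snd

open scoped TensorProduct in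
instance (P : PrimesAbove p k) : FiniteDimensional ℚ_[p] P.Completion :=
  let Φ : ℚ_[p] ⊗[ℚ] k →ₗ[ℚ_[p]] P.Completion :=
    (Algebra.TensorProduct.lift (Algebra.ofId ℚ_[p] P.Completion)
      (IsScalarTower.toAlgHom ℚ k P.Completion) (fun _ _ ↦ Commute.all ..)).toLinearMap
  have h_dense : DenseRange Φ := by
    apply (P.prime.denseRange_algebraMap k).mono
    rintro _ ⟨l, rfl⟩
    exact ⟨1 ⊗ₜ l, by simp [Φ]⟩
  .of_surjective Φ (by
    rw [← Set.range_eq_univ, ← Φ.coe_range, ← Φ.range.closed_of_finiteDimensional.closure_eq]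
    exact h_dense.closure_range)

theorem PrimesAbove.algebraMap_mem_integers (P : PrimesAbove p k) (z : ℤ_[p]) :
    algebraMap ℚ_[p] P.Completion z ∈ P.Integers := by
  have hcl : IsClosed {z : ℤ_[p] | algebraMap ℚ_[p] P.Completion z ∈ P.Integers} :=
    (Valued.isClosed_valuationSubring P.Completion).preimage
      (P.continuous_algebraMap.comp continuous_subtype_val)
  refine PadicInt.denseRange_intCast.induction_on z hcl fun a => ?_
  simp only [PadicInt.coe_intCast, map_intCast]
  exact intCast_mem P.Integers a

/-- The ring of integers of `k_𝔭` as an algebra over `ℤ_p`. -/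
instance (P : PrimesAbove p k) : Algebra ℤ_[p] P.Integers :=
  (((algebraMap ℚ_[p] P.Completion).comp (algebraMap ℤ_[p] ℚ_[p])).codRestrict
    P.Integers.toSubring P.algebraMap_mem_integers).toAlgebra

/-- The ramification index `e_𝔭` of `k_𝔭 / ℚ_p`. -/
def PrimesAbove.e (P : PrimesAbove p k) : ℕ :=
  (IsLocalRing.maximalIdeal P.Integers).ramificationIdx ℤ_[p]

end Completion

/-! ### The maximal unramified subextension -/

section Unramified

variable (p : ℕ) [Fact p.Prime]

/-- A finite extension `F / ℚ_p` is unramified if its ring of integers (the integral closure of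
`ℤ_p` in `F`) is unramified over `ℤ_p`. -/
def IsUnramifiedExt (F : Type*) [Field F] [Algebra ℚ_[p] F] : Prop :=
  letI : Algebra ℤ_[p] F := Algebra.compHom F (algebraMap ℤ_[p] ℚ_[p])
  FiniteDimensional ℚ_[p] F ∧ Algebra.FormallyUnramified ℤ_[p] (integralClosure ℤ_[p] F)

/-- The maximal unramified subextension of `L / ℚ_p`: the compositum of all unramified
subextensions. -/
def maxUnramified (L : Type*) [Field L] [Algebra ℚ_[p] L] : IntermediateField ℚ_[p] L :=
  sSup {F : IntermediateField ℚ_[p] L | IsUnramifiedExt p F}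

end Unramified

/-! ### Inertial equivalence classes -/

section Inertial

variable {p : ℕ} [Fact p.Prime] {k : Type*} [Field k] [NumberField k]

/-- The maximal unramified subextension `l_𝔭` of `k_𝔭 / ℚ_p`. -/
abbrev PrimesAbove.l (P : PrimesAbove p k) : IntermediateField ℚ_[p] P.Completion :=
  maxUnramified p P.Completion

/-- The finite set of `ℚ_p`-embeddings of `l_𝔭` into `ℚ̄_p`; it indexes the inertial classes
belonging to `𝔭`. -/
abbrev PrimesAbove.UnramifiedEmb (P : PrimesAbove p k) : Type _ := P.l →ₐ[ℚ_[p]] PadicAlgCl p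

instance (P : PrimesAbove p k) : Fintype P.UnramifiedEmb := Fintype.ofFinite _

/-- The inertial equivalence class `I_{𝔭,ρ}` of embeddings `σ : k → ℚ̄` (with `ℚ̄` embedded into
`ℚ̄_p` by `ι`): those `σ` for which `ι ∘ σ` has a `ℚ_p`-linear extension `k_𝔭 → ℚ̄_p` whose
restriction to `l_𝔭` is `ρ`. -/
def inertialClass (ι : AlgebraicClosure ℚ →+* PadicAlgCl p) (P : PrimesAbove p k)
    (ρ : P.UnramifiedEmb) : Set (k →+* AlgebraicClosure ℚ) :=
  {σ | ∃ τ : P.Completion →ₐ[ℚ_[p]] PadicAlgCl p,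
    (∀ x : k, τ (algebraMap k P.Completion x) = ι (σ x)) ∧ ∀ y : P.l, τ y = ρ y}

end Inertial

/-! ### Squared determinants -/

section Det

variable {k : Type*} [Field k]

open scoped Classical in
/-- The squared determinant `det²(σ(x))_{σ ∈ S, x ∈ X}`, for finite sets `S`, `X` of the same
size; an auxiliary matching of the rows and the columns is chosen. -/
def detSq (S : Finset (k →+* AlgebraicClosure ℚ)) (X : Finset (𝓞 k)) (h : S.card = X.card) :
    AlgebraicClosure ℚ :=
  (Matrix.of fun σ τ : S =>
    (σ : k →+* AlgebraicClosure ℚ) (Finset.equivOfCardEq h τ : 𝓞 k)).det ^ 2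

/-- The squared determinant does not depend on the orderings of rows and columns. -/
theorem detSq_eq (S : Finset (k →+* AlgebraicClosure ℚ)) (X : Finset (𝓞 k))
    (h : S.card = X.card) {ι : Type*} [Fintype ι] [DecidableEq ι] (r : ι ≃ S) (c : ι ≃ X) :
    detSq S X h = (Matrix.of fun i j : ι =>
      (r i : k →+* AlgebraicClosure ℚ) (c j : 𝓞 k)).det ^ 2 := by
  classical
  have hM : (Matrix.of fun i j : ι => (r i : k →+* AlgebraicClosure ℚ) (c j : 𝓞 k)) =
      (((Matrix.of fun σ τ : S => (σ : k →+* AlgebraicClosure ℚ)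
        (Finset.equivOfCardEq h τ : 𝓞 k))).submatrix id
        (r.symm.trans (c.trans (Finset.equivOfCardEq h).symm))).submatrix r r := by
    ext i j
    simp
  rw [hM, Matrix.det_submatrix_equiv_self, Matrix.det_permute', mul_pow, detSq]
  rw [← Int.cast_pow, ← Units.val_pow_eq_pow_val, Int.units_sq]
  simp

end Det

end

end InertialDet

open InertialDet

namespace InertialDet

/-! ### Determinants of evaluated polynomials -/

section Newton

open Polynomial

/-! Fix a uniformizer π of k_𝔭. Every element of valuation at least v is π^v times a power series in
π with integral digits in l_𝔭: residues lift to Teichmüller representatives, and an element with ζ^q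
= ζ generates an unramified extension (`PrimesAbove.exists_expansion`,
`mem_maxUnramified_of_pow_eq`). Take x ∈ 𝔫 and v = v_𝔭(𝔫), and apply the extension τ of σ ∈ I_{𝔭,ρ}.
This gives σ(x) = α^v ∑ ρ(a_i) α^i with α = τ(π). The coefficients depend on σ only through ρ, so
the rows of one inertial class are values of the same power series at different points α.

For polynomials, Newton interpolation inside each class shows that the Vandermonde products of all
classes divide the determinant (`prod_prod_sub_dvd_det`). Truncating the series and passing to the
limit turns this into a norm bound (`norm_det_le_of_tendsto`). Since ‖α‖ ≤ p^(-1/e), differences of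
points in a class obey the same bound. A class of s rows thus supplies s·v + s(s-1)/2 factors of
norm at most p^(-1/e), and squaring the determinant doubles the exponent. -/

/-- Newton interpolation: the values of a polynomial at a family of points are combinations of
the Newton basis polynomials, with coefficients in the base ring. -/
theorem exists_newton_coeff {R S : Type*} [CommRing R] [LinearOrder S] (α : S → R)
    (T : Finset S) (f : R[X]) :
    ∃ b : S → R, ∀ j ∈ T, f.eval (α j) =
      ∑ r ∈ T, (∏ t ∈ T with t < r, (α j - α t)) * b r := by
  induction T using Finset.induction_on_min generalizing f with
  | empty => simp
  | insert a T ha ih =>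
    -- As a is minimal, f = f(α a) + (X - α a)·g, and the factor α j - α a occurs in every Newton
    -- product with r ≠ a; the induction therefore runs on the quotient g.
    obtain ⟨b, hb⟩ := ih (f /ₘ (X - C (α a)))
    have haT : a ∉ T := fun h => lt_irrefl _ (ha a h)
    have hf : ∀ y, f.eval y = f.eval (α a) + (y - α a) * (f /ₘ (X - C (α a))).eval y := fun y => by
      conv_lhs => rw [← modByMonic_add_div f (X - C (α a)), modByMonic_X_sub_C_eq_C_eval]
      simp
    refine ⟨fun r => if r = a then f.eval (α a) else b r, fun j hj => ?_⟩
    have h1 : (insert a T).filter (· < a) = ∅ := by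
      ext t
      simp only [Finset.mem_filter, Finset.mem_insert, Finset.notMem_empty, iff_false, not_and,
        not_lt]
      rintro (rfl | h)
      · exact le_rfl
      · exact (ha t h).le
    have h2 : ∑ r ∈ T, (∏ t ∈ insert a T with t < r, (α j - α t)) *
        (if r = a then f.eval (α a) else b r) =
        (α j - α a) * ∑ r ∈ T, (∏ t ∈ T with t < r, (α j - α t)) * b r := by
      rw [Finset.mul_sum]
      refine Finset.sum_congr rfl fun r hr => ?_
      rw [if_neg (ne_of_mem_of_not_mem hr haT), Finset.filter_insert, if_pos (ha r hr),
        Finset.prod_insert (by simp [haT]), mul_assoc]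
    rw [Finset.sum_insert haT, h1, h2]
    simp only [Finset.prod_empty, if_true, one_mul]
    rcases Finset.mem_insert.mp hj with rfl | hj
    · simp
    · rw [← hb j hj, hf]

/-- If the rows of a square matrix are grouped into classes, and in each class the rows are the
values of the same polynomials at varying points, then the Vandermonde products of all classes
divide the determinant. -/
theorem prod_prod_sub_dvd_det {R S κ : Type*} [CommRing R] [LinearOrder S] [Fintype S]
    [DecidableEq κ] (c : S → κ) (α : S → R) (f : κ → S → R[X]) :
    (∏ σ, ∏ t with t < σ ∧ c t = c σ, (α σ - α t)) ∣
      (Matrix.of fun σ x => (f (c σ) x).eval (α σ)).det := by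
  choose b hb using fun (i : κ) (x : S) =>
    exists_newton_coeff α (Finset.univ.filter fun t => c t = i) (f i x)
  -- The matrix is L times the matrix of Newton coefficients. L is block diagonal along the classes,
  -- and its diagonal entries are the Vandermonde factors.
  set L : Matrix S S R := Matrix.of fun σ r =>
    if c r = c σ then ∏ t with t < r ∧ c t = c σ, (α σ - α t) else 0 with hL
  have hM : (Matrix.of fun σ x => (f (c σ) x).eval (α σ)) =
      L * Matrix.of fun r x => b (c r) x r := by
    ext σ x
    rw [Matrix.mul_apply, Matrix.of_apply, hb (c σ) x σ (by simp), Finset.sum_filter]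
    refine Finset.sum_congr rfl fun r _ => ?_
    by_cases h : c r = c σ
    · simp only [hL, Matrix.of_apply, h, if_true, Finset.filter_filter]
      simp only [and_comm]
    · simp [hL, h]
  have htri : L.BlockTriangular OrderDual.toDual := by
    intro σ r h
    have h' : σ < r := h
    simp only [hL, Matrix.of_apply]
    split_ifs with hc
    -- For σ < r in one class, t = σ itself occurs in the Newton product.
    · exact Finset.prod_eq_zero (i := σ) (by simp [h']) (sub_self _)
    · rfl
  rw [hM, Matrix.det_mul, Matrix.det_of_isLowerTriangular _ htri]
  refine (dvd_of_eq ?_).mul_right _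
  simp [hL]

end Newton

/-! ### Determinants of power series values over an ultrametric field -/

section Ultrametric

open Polynomial Filter Topology

variable {K S κ : Type*} [NormedField K] [IsUltrametricDist K] [LinearOrder S] [Fintype S]
  [DecidableEq κ]

/-- All data lie in the closed unit ball, which is a ring, and divisibility there is an inequality
of norms. The bound does not involve N, which permits a passage to the limit. -/
theorem norm_det_polynomial_le (c : S → κ) (α : S → K) (hα : ∀ σ, ‖α σ‖ ≤ 1)
    (a : ℕ → κ → S → K) (ha : ∀ i k x, ‖a i k x‖ ≤ 1) (N : ℕ) :
    ‖(Matrix.of fun σ x => ∑ i ∈ Finset.range N, a i (c σ) x * α σ ^ i).det‖ ≤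
      ∏ σ, ∏ t with t < σ ∧ c t = c σ, ‖α σ - α t‖ := by
  let A : Subring K := (NormedField.valuation (K := K)).integer
  have hA : ∀ {x : K}, x ∈ A ↔ ‖x‖ ≤ 1 := Iff.rfl
  obtain ⟨z, hz⟩ := prod_prod_sub_dvd_det c (fun σ => (⟨α σ, hA.2 (hα σ)⟩ : A))
    (fun k x => ∑ i ∈ Finset.range N, C (⟨a i k x, hA.2 (ha i k x)⟩ : A) * X ^ i)
  have h := congrArg A.subtype hz
  rw [RingHom.map_det, map_mul, map_prod] at h
  have hM : (Matrix.of fun σ x => ∑ i ∈ Finset.range N, a i (c σ) x * α σ ^ i) =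
      A.subtype.mapMatrix (Matrix.of fun σ x => (∑ i ∈ Finset.range N,
        C (⟨a i (c σ) x, hA.2 (ha i (c σ) x)⟩ : A) * X ^ i).eval ⟨α σ, hA.2 (hα σ)⟩) := by
    ext σ x
    simp [eval_finsetSum]
  rw [hM, h, norm_mul, norm_prod]
  have hzn : ‖A.subtype z‖ ≤ 1 := hA.1 z.2
  refine (mul_le_of_le_one_right (by positivity) hzn).trans (le_of_eq ?_)
  simp [norm_prod]

theorem norm_det_le_of_tendsto (c : S → κ) (α : S → K) (hα : ∀ σ, ‖α σ‖ ≤ 1)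
    (a : ℕ → κ → S → K) (ha : ∀ i k x, ‖a i k x‖ ≤ 1) (v : κ → ℕ) (M : Matrix S S K)
    (hM : ∀ σ x, Tendsto (fun N => α σ ^ v (c σ) * ∑ i ∈ Finset.range N, a i (c σ) x * α σ ^ i)
      atTop (𝓝 (M σ x))) :
    ‖M.det‖ ≤ ∏ σ, (‖α σ‖ ^ v (c σ) * ∏ t with t < σ ∧ c t = c σ, ‖α σ - α t‖) := by
  have hlim : Tendsto (fun N => Matrix.of fun σ x =>
      α σ ^ v (c σ) * ∑ i ∈ Finset.range N, a i (c σ) x * α σ ^ i) atTop (𝓝 M) :=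
    tendsto_pi_nhds.2 fun σ => tendsto_pi_nhds.2 fun x => hM σ x
  have hdet := ((Continuous.matrix_det continuous_id).norm.tendsto M).comp hlim
  refine le_of_tendsto' hdet fun N => ?_
  have := Matrix.det_mul_column (fun σ => α σ ^ v (c σ))
    (Matrix.of fun σ x => ∑ i ∈ Finset.range N, a i (c σ) x * α σ ^ i)
  simp only [Matrix.of_apply] at this
  simp only [Function.comp_apply, id]
  rw [this, norm_mul, norm_prod, Finset.prod_mul_distrib]
  simp only [norm_pow]
  gcongr
  exact norm_det_polynomial_le c α hα a ha N

/-- Counts the pairs t < σ; this is the source of the term s(s - 1). -/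
theorem sum_card_filter_lt {S : Type*} [LinearOrder S] (T : Finset S) :
    2 * ∑ σ ∈ T, ((T.filter (· < σ)).card : ℝ) = T.card * (T.card - 1) := by
  induction T using Finset.induction_on_max with
  | empty => simp
  | insert a T ha ih =>
    have haT : a ∉ T := fun h => lt_irrefl _ (ha a h)
    have h1 : (insert a T).filter (· < a) = T := by
      rw [Finset.filter_insert, if_neg (lt_irrefl a), Finset.filter_true_of_mem ha]
    have h2 : ∀ σ ∈ T, (((insert a T).filter (· < σ)).card : ℝ) = (T.filter (· < σ)).card :=
      fun σ hσ => by rw [Finset.filter_insert, if_neg (ha σ hσ).not_gt]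
    rw [Finset.sum_insert haT, h1, Finset.sum_congr rfl h2, mul_add, ih,
      Finset.card_insert_of_notMem haT]
    push_cast
    ring

end Ultrametric

/-! ### Roots of unity of order prime to `p` generate unramified extensions -/

section Unramified

open Polynomial

/-- Differentiating x^n = 1 gives n x^(n-1) dx = 0 with n and x units, so dx = 0 and the module of
differentials vanishes. -/
theorem formallyUnramified_of_adjoin_eq_top {A B : Type*} [CommRing A] [CommRing B] [Algebra A B]
    {x : B} (hx : Algebra.adjoin A {x} = ⊤) {n : ℕ} (hxn : x ^ n = 1) (hn : IsUnit (n : A)) :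
    Algebra.FormallyUnramified A B := by
  have hxu : IsUnit x := by
    rcases n with - | n
    · have h01 : IsUnit (0 : B) := by simpa using hn.map (algebraMap A B)
      have := isUnit_zero_iff.mp h01
      have := subsingleton_of_zero_eq_one this
      exact isUnit_of_subsingleton x
    · exact IsUnit.of_mul_eq_one (x ^ n) (by rw [← pow_succ', hxn])
  have hD : KaehlerDifferential.D A B = 0 := by
    refine Derivation.ext_of_adjoin_eq_top {x} hx ?_
    rintro _ rfl
    have h := congrArg (KaehlerDifferential.D A B) hxn
    rw [Derivation.leibniz_pow, Derivation.map_one_eq_zero, ← Nat.cast_smul_eq_nsmul A] at h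
    rw [hn.smul_eq_zero, (hxu.pow _).smul_eq_zero] at h
    simpa using h
  refine ⟨subsingleton_of_forall_eq 0 fun y => ?_⟩
  have hy : y ∈ Submodule.span B (Set.range (KaehlerDifferential.D A B)) := by
    rw [KaehlerDifferential.span_range_derivation]; trivial
  have h0 : Submodule.span B (Set.range (KaehlerDifferential.D A B)) ≤ ⊥ := by
    rw [Submodule.span_le]
    rintro _ ⟨b, rfl⟩
    simp [hD]
  exact h0 hy

/-- The point is that ζ generates the whole integral closure over A: f'(ζ), for f its minimal
polynomial, divides n ζ^(n-1) and is a unit, while conductor times different is the ideal (f'(ζ)),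
so the conductor is trivial. -/
theorem formallyUnramified_integralClosure (A K L : Type*) [CommRing A] [IsDedekindDomain A]
    [Field K] [Algebra A K] [IsFractionRing A K] [Field L] [Algebra K L]
    [Algebra A L] [IsScalarTower A K L] [FiniteDimensional K L] [Algebra.IsSeparable K L]
    {ζ : L} (hζ : Algebra.adjoin K {ζ} = ⊤) {n : ℕ} (hζn : ζ ^ n = 1) (hn : IsUnit (n : A)) :
    Algebra.FormallyUnramified A (integralClosure A L) := by
  have hn0 : n ≠ 0 := by
    rintro rfl
    simp at hn
  have hint : IsIntegral A ζ := IsIntegral.of_pow (Nat.pos_of_ne_zero hn0) (hζn ▸ isIntegral_one)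
  have : FaithfulSMul A L := (faithfulSMul_iff_algebraMap_injective A L).mpr <| by
    rw [IsScalarTower.algebraMap_eq A K L]
    exact (algebraMap K L).injective.comp (IsFractionRing.injective A K)
  let B := integralClosure A L
  have : FaithfulSMul A B := (faithfulSMul_iff_algebraMap_injective A B).mpr fun a b h =>
    FaithfulSMul.algebraMap_injective A L (congrArg Subtype.val h)
  have : Module.IsTorsionFree A B := inferInstance
  let x : B := ⟨ζ, hint⟩
  have hxn : x ^ n = 1 := Subtype.ext hζn
  have : IsDedekindDomain B := integralClosure.isDedekindDomain A K L
  have : IsFractionRing B L := integralClosure.isFractionRing_of_finite_extension K L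
  have hxi : IsIntegral A x := IsIntegralClosure.isIntegral A L x
  have hcond := conductor_mul_differentIdeal A K L x hζ
  have hunit : IsUnit (aeval x (derivative (minpoly A x))) := by
    obtain ⟨h, hh⟩ : minpoly A x ∣ X ^ n - 1 :=
      minpoly.isIntegrallyClosed_dvd hxi (by simp [hxn])
    have h1 := congrArg (fun f => aeval x (derivative f)) hh
    simp only [derivative_sub, derivative_X_pow, derivative_one, sub_zero, derivative_mul,
      map_add, map_mul, minpoly.aeval, zero_mul, add_zero, map_natCast, map_pow, aeval_X] at h1
    have hu : IsUnit ((n : B) * x ^ (n - 1)) := by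
      refine IsUnit.mul (by simpa using hn.map (algebraMap A B)) (IsUnit.pow _ ?_)
      exact IsUnit.of_mul_eq_one (x ^ (n - 1)) (by rw [← pow_succ', Nat.sub_add_cancel
        (Nat.pos_of_ne_zero hn0), hxn])
    rw [h1] at hu
    exact isUnit_of_mul_isUnit_left hu
  rw [Ideal.span_singleton_eq_top.mpr hunit] at hcond
  have htop : Algebra.adjoin A {x} = ⊤ := by
    rw [← conductor_eq_top_iff_adjoin_eq_top, eq_top_iff, ← hcond]
    exact Ideal.mul_le_left
  exact formallyUnramified_of_adjoin_eq_top htop hxn hn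

variable (p : ℕ) [Fact p.Prime]

theorem mem_maxUnramified_of_pow_eq {L : Type*} [Field L] [Algebra ℚ_[p] L]
    [FiniteDimensional ℚ_[p] L] {ζ : L} {q : ℕ} (hq : 1 < q) (hpq : p ∣ q) (hζ : ζ ^ q = ζ) :
    ζ ∈ maxUnramified p L := by
  rcases eq_or_ne ζ 0 with rfl | hζ0
  · exact zero_mem _
  let F : IntermediateField ℚ_[p] L := IntermediateField.adjoin ℚ_[p] {ζ}
  have hF : IsUnramifiedExt p F := by
    let : Algebra ℤ_[p] F := Algebra.compHom F (algebraMap ℤ_[p] ℚ_[p])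
    have : IsScalarTower ℤ_[p] ℚ_[p] F := .of_algebraMap_eq fun _ => rfl
    refine ⟨inferInstance, ?_⟩
    -- The exponent q - 1 is prime to p because p divides q.
    have hz : IntermediateField.AdjoinSimple.gen ℚ_[p] ζ ^ (q - 1) = 1 := by
      apply Subtype.ext
      have : ζ ^ (q - 1) * ζ = 1 * ζ := by
        rw [← pow_succ, Nat.sub_add_cancel hq.le, one_mul, hζ]
      simpa using mul_right_cancel₀ hζ0 this
    refine formallyUnramified_integralClosure ℤ_[p] ℚ_[p] F
      (ζ := IntermediateField.AdjoinSimple.gen ℚ_[p] ζ) ?_ hz ?_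
    · have hi : IsIntegral ℚ_[p] ζ := Algebra.IsIntegral.isIntegral ζ
      have := (IntermediateField.adjoin.powerBasis hi).adjoin_gen_eq_top
      rwa [IntermediateField.adjoin.powerBasis_gen] at this
    · rw [PadicInt.isUnit_iff, PadicInt.norm_natCast_eq_one_iff]
      refine (Nat.Prime.coprime_iff_not_dvd Fact.out).mpr fun h => ?_
      have := (Nat.dvd_sub_iff_right hq.le hpq).mp h
      exact (Fact.out : p.Prime).one_lt.ne' (Nat.dvd_one.mp this)
  exact (le_sSup (show F ∈ {F : IntermediateField ℚ_[p] L | IsUnramifiedExt p F} from hF))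
    (IntermediateField.mem_adjoin_simple_self ℚ_[p] ζ)

end Unramified

/-! ### The completions `k_𝔭` -/

section Completion

open WithZero Filter Topology

variable {p : ℕ} {k : Type*} [Field k] [NumberField k]

theorem lt_one_iff_le_exp_neg_one {x : ℤᵐ⁰} : x < 1 ↔ x ≤ exp (-1 : ℤ) := by
  rcases eq_or_ne x 0 with rfl | hx
  · simp
  · rw [← exp_log hx, ← exp_zero, exp_lt_exp, exp_le_exp]
    omega

theorem isClopen_valued_lt_one {R Γ₀ : Type*} [Ring R] [LinearOrderedCommGroupWithZero Γ₀]
    [Valued R Γ₀] : IsClopen {x : R | Valued.v x < 1} := by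
  simpa only [Valuation.restrict_lt_one_iff] using Valued.isClopen_ball R (Γ₀ := Γ₀) 1

open MonoidWithZeroHom.ValueGroup₀ in
theorem tendsto_zero_of_valued_le_exp {R : Type*} [Ring R] [Valued R ℤᵐ⁰] (u : ℕ → R)
    (hu : ∀ n, Valued.v (u n) ≤ exp (-(n : ℤ))) : Tendsto u atTop (𝓝 0) := by
  rw [(Valued.hasBasis_nhds_zero R ℤᵐ⁰).tendsto_right_iff]
  rintro γ -
  filter_upwards [eventually_gt_atTop (log (embedding γ.val)).natAbs] with n hn
  rw [Valuation.restrict_lt_iff_lt_embedding]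
  refine (hu n).trans_lt ?_
  rw [← exp_log (embedding_unit_ne_zero γ), exp_lt_exp]
  omega

theorem PrimesAbove.valued_algebraMap (P : PrimesAbove p k) (x : k) :
    Valued.v (algebraMap k P.Completion x) = P.prime.valuation k x := by
  rw [HeightOneSpectrum.algebraMap_adicCompletion]
  exact HeightOneSpectrum.valuedAdicCompletion_eq_valuation' P.prime x

theorem PrimesAbove.valued_algebraMap_integer (P : PrimesAbove p k) (a : 𝓞 k) :
    Valued.v (algebraMap k P.Completion a) = P.prime.intValuation a := by
  rw [P.valued_algebraMap]
  exact P.prime.valuation_of_algebraMap a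

theorem PrimesAbove.exists_valued_sub_lt (P : PrimesAbove p k) (x : P.Completion) :
    ∃ y : k, Valued.v (x - algebraMap k P.Completion y) < 1 := by
  have hopen : IsOpen {z : P.Completion | Valued.v (x - z) < 1} :=
    isClopen_valued_lt_one.isOpen.preimage (continuous_sub_left x)
  obtain ⟨y, hy⟩ := (P.prime.denseRange_algebraMap k).exists_mem_open hopen ⟨x, by simp⟩
  exact ⟨y, hy⟩

theorem PrimesAbove.exists_integer_valued_sub_lt (P : PrimesAbove p k) (x : P.Completion)
    (hx : Valued.v x ≤ 1) : ∃ a : 𝓞 k, Valued.v (x - algebraMap k P.Completion a) < 1 := by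
  obtain ⟨y, hy⟩ := P.exists_valued_sub_lt x
  have hy1 : P.prime.valuation k y ≤ 1 := by
    rw [← P.valued_algebraMap]
    have := Valuation.map_sub_le _ hx hy.le
    rwa [sub_sub_cancel] at this
  obtain ⟨a, ha⟩ := P.prime.exists_valuation_sub_lt_of_integer hy1 1
  refine ⟨a, ?_⟩
  have h2 : Valued.v (algebraMap k P.Completion y - algebraMap k P.Completion a) < 1 := by
    rw [← map_sub, P.valued_algebraMap, Valuation.map_sub_swap]
    exact_mod_cast ha
  have := Valuation.map_add_lt _ hy h2
  rwa [sub_add_sub_cancel] at this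

/-- The cardinality of the residue field of `𝔭`. -/
noncomputable def PrimesAbove.q (P : PrimesAbove p k) : ℕ := Ideal.absNorm P.prime.asIdeal

theorem PrimesAbove.one_lt_q (P : PrimesAbove p k) : 1 < P.q :=
  NumberField.HeightOneSpectrum.one_lt_absNorm P.prime

theorem PrimesAbove.dvd_q [Fact p.Prime] (P : PrimesAbove p k) : p ∣ P.q := by
  by_contra h
  obtain ⟨a, b, hab⟩ := Nat.isCoprime_iff_coprime.mpr
    (((Nat.Prime.coprime_iff_not_dvd Fact.out).mpr h : p.Coprime P.q))
  apply P.prime.isPrime.ne_top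
  rw [Ideal.eq_top_iff_one]
  have h1 : (1 : 𝓞 k) = (a : 𝓞 k) * p + b * P.q := by exact_mod_cast congrArg (Int.cast) hab.symm
  rw [h1]
  exact add_mem (Ideal.mul_mem_left _ _ P.2)
    (Ideal.mul_mem_left _ _ (Ideal.absNorm_mem P.prime.asIdeal))

theorem PrimesAbove.pow_q_sub_mem (P : PrimesAbove p k) (a : 𝓞 k) :
    a ^ P.q - a ∈ P.prime.asIdeal := by
  have hmax := P.prime.isMaximal
  let : Field (𝓞 k ⧸ P.prime.asIdeal) := Ideal.Quotient.field _
  have : Finite (𝓞 k ⧸ P.prime.asIdeal) :=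
    P.prime.asIdeal.finiteQuotientOfFreeOfNeBot P.prime.ne_bot
  let : Fintype (𝓞 k ⧸ P.prime.asIdeal) := Fintype.ofFinite _
  have hq : P.q = Fintype.card (𝓞 k ⧸ P.prime.asIdeal) := by
    rw [← Nat.card_eq_fintype_card]; rfl
  rw [← Ideal.Quotient.eq_zero_iff_mem, map_sub, map_pow, hq, FiniteField.pow_card, sub_self]

/-- Since q ∈ 𝔭, raising a congruence to the q-th power improves its modulus by one power of 𝔭. This
makes a^(q^n) a Cauchy sequence. -/
theorem PrimesAbove.pow_q_pow_sub_mem (P : PrimesAbove p k) (a : 𝓞 k) (n : ℕ) :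
    a ^ P.q ^ (n + 1) - a ^ P.q ^ n ∈ P.prime.asIdeal ^ (n + 1) := by
  have h : a ^ P.q ≡ a [SMOD P.prime.asIdeal] := SModEq.sub_mem.mpr (P.pow_q_sub_mem a)
  have := SModEq.sub_mem.mp (SModEq.pow_pow_add_one (Ideal.absNorm_mem P.prime.asIdeal) h n)
  change a ^ P.q ^ (n + 1) - _ ∈ _
  rwa [pow_succ' P.q, pow_mul]

/-- Teichmüller representatives in `k_𝔭`. -/
theorem PrimesAbove.exists_teichmuller (P : PrimesAbove p k) (x : P.Completion)
    (hx : Valued.v x ≤ 1) : ∃ ζ : P.Completion, ζ ^ P.q = ζ ∧ Valued.v (x - ζ) < 1 := by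
  obtain ⟨a, ha⟩ := P.exists_integer_valued_sub_lt x hx
  let u : ℕ → P.Completion := fun n => algebraMap k P.Completion a ^ P.q ^ n
  have hu : ∀ n, Valued.v (u (n + 1) - u n) ≤ exp (-((n + 1 : ℕ) : ℤ)) := fun n => by
    have : u (n + 1) - u n = algebraMap k P.Completion
        ((a ^ P.q ^ (n + 1) - a ^ P.q ^ n : 𝓞 k) : k) := by simp [u]
    rw [this, P.valued_algebraMap_integer, HeightOneSpectrum.intValuation_le_pow_iff_mem]
    exact P.pow_q_pow_sub_mem a n
  have hcauchy : CauchySeq u := by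
    refine NonarchimedeanAddGroup.cauchySeq_of_tendsto_sub_nhds_zero ?_
    refine tendsto_zero_of_valued_le_exp _ fun n => (hu n).trans ?_
    rw [exp_le_exp]; omega
  obtain ⟨ζ, hζ⟩ := cauchySeq_tendsto_of_complete hcauchy
  refine ⟨ζ, ?_, ?_⟩
  · refine tendsto_nhds_unique (hζ.pow P.q) ?_
    have := hζ.comp (tendsto_add_atTop_nat 1)
    refine this.congr fun n => ?_
    simp only [Function.comp_apply, u, ← pow_mul, pow_succ]
  -- All terms stay in the residue class of a, which is closed and so contains the limit.
  · have hlt : ∀ n, Valued.v (u n - algebraMap k P.Completion a) < 1 := fun n => by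
      induction n with
      | zero => simp [u]
      | succ n ih =>
        have h1 : Valued.v (u (n + 1) - u n) < 1 := (hu n).trans_lt (by
          rw [← exp_zero, exp_lt_exp]; push_cast; omega)
        have := Valuation.map_add_lt _ h1 ih
        rwa [sub_add_sub_cancel] at this
    have hcl : IsClosed {z : P.Completion | Valued.v (z - algebraMap k P.Completion a) < 1} :=
      (isClopen_valued_lt_one (R := P.Completion)).isClosed.preimage (continuous_sub_right _)
    have hζa := hcl.mem_of_tendsto hζ (Eventually.of_forall hlt)
    rw [Set.mem_ofPred_eq, Valuation.map_sub_swap] at hζa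
    have := Valuation.map_add_lt _ ha hζa
    rwa [sub_add_sub_cancel] at this

theorem PrimesAbove.exists_uniformizer (P : PrimesAbove p k) :
    ∃ π : P.Completion, Valued.v π = exp (-1 : ℤ) := by
  obtain ⟨π, hπ⟩ := P.prime.valuation_exists_uniformizer k
  exact ⟨algebraMap k P.Completion π, by rw [P.valued_algebraMap, hπ]⟩

theorem PrimesAbove.valued_natCast_lt (P : PrimesAbove p k) :
    Valued.v (p : P.Completion) < 1 := by
  have h := P.valued_algebraMap_integer (p : 𝓞 k)
  have := (P.prime.intValuation_lt_one_iff_mem (p : 𝓞 k)).mpr P.2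
  rw [← h] at this
  simpa using this

theorem PrimesAbove.valued_le_of_mem (P : PrimesAbove p k) {𝔫 : Ideal (𝓞 k)} {x : 𝓞 k}
    (hx : x ∈ 𝔫) : Valued.v (algebraMap k P.Completion x) ≤
      exp (-(multiplicity P.prime.asIdeal 𝔫 : ℤ)) := by
  rw [P.valued_algebraMap_integer, HeightOneSpectrum.intValuation_le_pow_iff_mem]
  exact Ideal.le_of_dvd (pow_multiplicity_dvd _ _) hx

theorem PrimesAbove.maximalIdeal_eq_span (P : PrimesAbove p k) (π : P.Integers)
    (hπ : Valued.v (π : P.Completion) = exp (-1 : ℤ)) :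
    IsLocalRing.maximalIdeal P.Integers = Ideal.span {π} := by
  ext x
  rw [Ideal.mem_span_singleton,
    (HeightOneSpectrum.adicCompletionIntegers.integers (K := k) P.prime).dvd_iff_le,
    IsLocalRing.mem_maximalIdeal, mem_nonunits_iff,
    HeightOneSpectrum.adicCompletionIntegers.isUnit_iff_valued_eq_one]
  have hx : Valued.v (x : P.Completion) ≤ 1 := x.2
  change _ ↔ Valued.v (x : P.Completion) ≤ Valued.v (π : P.Completion)
  rw [hπ, ← lt_one_iff_le_exp_neg_one]
  exact ⟨fun h => lt_of_le_of_ne hx h, fun h => h.ne⟩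

variable [Fact p.Prime]

theorem PrimesAbove.exists_mem_l_valued_sub_lt (P : PrimesAbove p k) (x : P.Completion)
    (hx : Valued.v x ≤ 1) : ∃ ζ : P.l, Valued.v (ζ : P.Completion) ≤ 1 ∧
      Valued.v (x - ζ) < 1 := by
  obtain ⟨ζ, hζ, hxζ⟩ := P.exists_teichmuller x hx
  refine ⟨⟨ζ, mem_maxUnramified_of_pow_eq p P.one_lt_q P.dvd_q hζ⟩, ?_, hxζ⟩
  have := Valuation.map_sub_le _ hx hxζ.le
  rwa [sub_sub_cancel] at this

theorem PrimesAbove.natCast_ne_zero (P : PrimesAbove p k) : (p : P.Completion) ≠ 0 := by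
  rw [← map_natCast (algebraMap ℚ_[p] P.Completion), map_ne_zero]
  exact_mod_cast (Fact.out : p.Prime).ne_zero

/-- The valuation of `p` in `k_𝔭` is the ramification index. -/
theorem PrimesAbove.valued_natCast (P : PrimesAbove p k) :
    Valued.v (p : P.Completion) = exp (-(P.e : ℤ)) := by
  have h0 : Valued.v (p : P.Completion) ≠ 0 := by simpa using P.natCast_ne_zero
  obtain ⟨n, hn⟩ : ∃ n : ℕ, Valued.v (p : P.Completion) = exp (-(n : ℤ)) := by
    have := P.valued_natCast_lt
    rw [← exp_log h0, ← exp_zero, exp_lt_exp] at this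
    refine ⟨(-log (Valued.v (p : P.Completion))).toNat, ?_⟩
    rw [Int.toNat_of_nonneg (by omega), neg_neg, exp_log h0]
  obtain ⟨π', hπ'⟩ := P.exists_uniformizer
  let π : P.Integers := ⟨π', show Valued.v π' ≤ 1 by
    rw [hπ', ← exp_zero, exp_le_exp]; omega⟩
  have hm := P.maximalIdeal_eq_span π hπ'
  have hmap : (IsLocalRing.maximalIdeal ℤ_[p]).map (algebraMap ℤ_[p] P.Integers) =
      Ideal.span {(p : P.Integers)} := by
    rw [PadicInt.maximalIdeal_eq_span_p, Ideal.map_span, Set.image_singleton, map_natCast]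
  -- The ramification index is the largest j for which p lies in the j-th power of the maximal
  -- ideal.
  have hle : ∀ j : ℕ, (IsLocalRing.maximalIdeal ℤ_[p]).map (algebraMap ℤ_[p] P.Integers) ≤
      IsLocalRing.maximalIdeal P.Integers ^ j ↔ j ≤ n := fun j => by
    rw [hmap, hm, Ideal.span_singleton_pow, Ideal.span_singleton_le_span_singleton,
      (HeightOneSpectrum.adicCompletionIntegers.integers (K := k) P.prime).dvd_iff_le]
    change Valued.v ((p : P.Integers) : P.Completion) ≤
      Valued.v ((π ^ j : P.Integers) : P.Completion) ↔ _
    have : Valued.v ((π ^ j : P.Integers) : P.Completion) = exp (-(j : ℤ)) := by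
      rw [SubmonoidClass.coe_pow, map_pow, hπ', ← exp_nsmul]
      simp
    rw [this, show ((p : P.Integers) : P.Completion) = p from rfl, hn, exp_le_exp]
    omega
  have hover : (IsLocalRing.maximalIdeal P.Integers).LiesOver (IsLocalRing.maximalIdeal ℤ_[p]) := by
    refine ⟨(IsLocalRing.maximalIdeal.isMaximal ℤ_[p]).eq_of_le
      (Ideal.comap_ne_top _ (IsLocalRing.maximalIdeal.isMaximal _).ne_top) ?_⟩
    rw [← Ideal.map_le_iff_le_comap, ← pow_one (IsLocalRing.maximalIdeal P.Integers), hle]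
    have := P.valued_natCast_lt
    rw [hn, ← exp_zero, exp_lt_exp] at this
    omega
  have he : P.e = n := by
    rw [PrimesAbove.e, ← Ideal.ramificationIdx'_eq_ramificationIdx'
      (IsLocalRing.maximalIdeal ℤ_[p])]
    · exact Ideal.ramificationIdx'_spec ((hle n).2 le_rfl) (by rw [hle]; omega)
    · rw [hmap, Ne, Ideal.span_singleton_eq_bot]
      exact fun h => P.natCast_ne_zero (congrArg Subtype.val h)
  rw [he, hn]

theorem PrimesAbove.e_pos (P : PrimesAbove p k) : 0 < P.e := by
  have := P.valued_natCast_lt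
  rw [P.valued_natCast, ← exp_zero, exp_lt_exp] at this
  omega

/-! ### Embeddings of `k_𝔭` into `ℚ̄_p` -/

variable {P : PrimesAbove p k} (τ : P.Completion →ₐ[ℚ_[p]] PadicAlgCl p)

theorem continuous_embedding : Continuous τ :=
  τ.toLinearMap.continuous_of_finiteDimensional

/-- Powers of x tend to 0, and τ is continuous because k_𝔭 is finite-dimensional over ℚ_p. No
explicit comparison of the two absolute values is needed. -/
theorem norm_embedding_lt_one {x : P.Completion} (hx : Valued.v x < 1) : ‖τ x‖ < 1 := by
  have h0 := Valued.tendsto_zero_pow_of_v_lt_one hx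
  have h1 := ((continuous_embedding τ).norm.tendsto 0).comp h0
  simp only [Function.comp_def, map_pow, map_zero, norm_zero, norm_pow] at h1
  simpa using tendsto_pow_atTop_nhds_zero_iff.mp h1

theorem norm_embedding_le_one {x : P.Completion} (hx : Valued.v x ≤ 1) : ‖τ x‖ ≤ 1 := by
  obtain ⟨π, hπ⟩ := P.exists_uniformizer
  by_contra! h
  have hπ0 : 0 < ‖τ π‖ := by
    rw [norm_pos_iff, map_ne_zero]
    rintro rfl
    rw [map_zero] at hπ
    exact exp_ne_zero hπ.symm
  obtain ⟨n, hn⟩ := pow_unbounded_of_one_lt (‖τ π‖⁻¹) h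
  -- If ‖τ x‖ > 1, a large n makes the norm of τ(π x^n) exceed 1, although π x^n has valuation below
  -- 1.
  have h1 : ‖τ (π * x ^ n)‖ < 1 := by
    refine norm_embedding_lt_one τ ?_
    rw [map_mul, map_pow]
    refine (mul_le_of_le_one_right' (pow_le_one' hx n)).trans_lt ?_
    rw [hπ, ← exp_zero, exp_lt_exp]; omega
  rw [map_mul, map_pow, norm_mul, norm_pow] at h1
  rw [inv_lt_iff_one_lt_mul₀' hπ0] at hn
  linarith

/-- π^e / p has valuation 1 and hence image of norm at most 1; take e-th roots. -/
theorem norm_embedding_uniformizer_le {π : P.Completion} (hπ : Valued.v π = exp (-1 : ℤ)) :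
    ‖τ π‖ ≤ (p : ℝ) ^ (-(1 / (P.e : ℝ))) := by
  have hp : (0 : ℝ) < p := by exact_mod_cast (Fact.out : p.Prime).pos
  have he : (0 : ℝ) < P.e := by exact_mod_cast P.e_pos
  have h1 : ‖τ (π ^ P.e / p)‖ ≤ 1 := by
    refine norm_embedding_le_one τ (le_of_eq ?_)
    rw [map_div₀, P.valued_natCast, map_pow, hπ, ← exp_nsmul]
    simp
  have hpn : ‖τ (p : P.Completion)‖ = (p : ℝ)⁻¹ := by
    rw [map_natCast, ← map_natCast (algebraMap ℚ_[p] (PadicAlgCl p)), PadicAlgCl.norm_extends,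
      Padic.norm_p]
  rw [map_div₀, norm_div, map_pow, norm_pow, hpn, div_inv_eq_mul, ← le_div_iff₀ hp] at h1
  calc ‖τ π‖ = (‖τ π‖ ^ (P.e : ℝ)) ^ (1 / (P.e : ℝ)) := by
        rw [← Real.rpow_mul (norm_nonneg _), mul_one_div_cancel he.ne', Real.rpow_one]
    _ ≤ (1 / (p : ℝ)) ^ (1 / (P.e : ℝ)) := by
        rw [Real.rpow_natCast]
        gcongr
    _ = _ := by rw [one_div, Real.inv_rpow hp.le, Real.rpow_neg hp.le]

theorem PrimesAbove.exists_expansion (P : PrimesAbove p k) {π : P.Completion}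
    (hπ : Valued.v π = exp (-1 : ℤ)) (n : ℕ) (x : P.Completion)
    (hx : Valued.v x ≤ exp (-(n : ℤ))) :
    ∃ a : ℕ → P.l, (∀ i, Valued.v (a i : P.Completion) ≤ 1) ∧
      Tendsto (fun N => π ^ n * ∑ i ∈ Finset.range N, (a i : P.Completion) * π ^ i)
        atTop (𝓝 x) := by
  have hπ0 : π ≠ 0 := by
    rintro rfl
    rw [map_zero] at hπ
    exact exp_ne_zero hπ.symm
  have hπn : ∀ j : ℕ, Valued.v (π ^ j) = exp (-(j : ℤ)) := fun j => by
    rw [map_pow, hπ, ← exp_nsmul]; simp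
  choose! ζ hζ hζx using P.exists_mem_l_valued_sub_lt
  -- Successive remainders: subtract the digit in l_𝔭 congruent to the remainder, then divide by π.
  let r : ℕ → P.Completion := fun i => Nat.rec (x / π ^ n) (fun _ y => (y - ζ y) / π) i
  have hr : ∀ i, r (i + 1) = (r i - ζ (r i)) / π := fun i => rfl
  have hr1 : ∀ i, Valued.v (r i) ≤ 1 := fun i => by
    induction i with
    | zero =>
      change Valued.v (x / π ^ n) ≤ 1
      rw [map_div₀, hπn, div_le_one₀ (by simp)]
      exact hx
    | succ i ih =>
      rw [hr, map_div₀, hπ, div_le_one₀ (by simp), ← lt_one_iff_le_exp_neg_one]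
      exact hζx _ ih
  have hsum : ∀ N, x - π ^ n * ∑ i ∈ Finset.range N, (ζ (r i) : P.Completion) * π ^ i =
      π ^ n * π ^ N * r N := fun N => by
    induction N with
    | zero =>
      have : r 0 = x / π ^ n := rfl
      rw [this]
      field_simp
      simp
    | succ N ih =>
      rw [Finset.sum_range_succ, mul_add, ← sub_sub, ih, hr, pow_succ]
      field_simp
  refine ⟨fun i => ζ (r i), fun i => hζ _ (hr1 i), ?_⟩
  rw [← tendsto_sub_nhds_zero_iff, ← neg_zero]
  refine (tendsto_zero_of_valued_le_exp (fun N => π ^ n * π ^ N * r N) fun N => ?_).neg.congr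
    fun N => by rw [← hsum, neg_sub]
  rw [map_mul, map_mul, hπn, hπn]
  refine (mul_le_mul' (mul_le_mul' ?_ le_rfl) (hr1 N)).trans_eq
    (b := 1 * exp (-(N : ℤ)) * 1) (by simp)
  rw [← exp_zero, exp_le_exp]
  omega

end Completion

/-! ### Inertial classes are disjoint -/

section Inertial

open WithZero Filter Topology

variable {p : ℕ} [Fact p.Prime] {k : Type*} [Field k] [NumberField k]

theorem mem_prime_iff_norm_lt_one {P : PrimesAbove p k} (τ : P.Completion →ₐ[ℚ_[p]] PadicAlgCl p)
    (a : 𝓞 k) : a ∈ P.prime.asIdeal ↔ ‖τ (algebraMap k P.Completion a)‖ < 1 := by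
  rw [← P.prime.intValuation_lt_one_iff_mem, ← P.valued_algebraMap_integer]
  refine ⟨norm_embedding_lt_one τ, fun h => ?_⟩
  by_contra! hv
  have h1 : ‖τ (algebraMap k P.Completion a)⁻¹‖ ≤ 1 :=
    norm_embedding_le_one τ (by rw [map_inv₀]; exact inv_le_one_of_one_le₀ hv)
  have h0 : algebraMap k P.Completion a ≠ 0 := by
    intro h
    rw [h, map_zero] at hv
    exact absurd hv (by simp)
  have h2 : ‖τ (algebraMap k P.Completion a)‖ * ‖τ (algebraMap k P.Completion a)⁻¹‖ = 1 := by
    rw [← norm_mul, ← map_mul, mul_inv_cancel₀ h0, map_one, norm_one]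
  nlinarith [norm_nonneg (τ (algebraMap k P.Completion a))]

/-- The prime is recovered from ι ∘ σ as the set of integers whose image has norm below 1. Then τ,
being continuous, is determined on the dense subfield k, and so is its restriction ρ. -/
theorem eq_of_mem_inertialClass {ι : AlgebraicClosure ℚ →+* PadicAlgCl p}
    {σ : k →+* AlgebraicClosure ℚ} {c c' : Σ P : PrimesAbove p k, P.UnramifiedEmb}
    (h : σ ∈ inertialClass ι c.1 c.2) (h' : σ ∈ inertialClass ι c'.1 c'.2) : c = c' := by
  obtain ⟨P, ρ⟩ := c
  obtain ⟨P', ρ'⟩ := c'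
  obtain ⟨τ, hτ, hρ⟩ := h
  obtain ⟨τ', hτ', hρ'⟩ := h'
  obtain rfl : P = P' := by
    refine Subtype.ext (HeightOneSpectrum.ext (Ideal.ext fun a => ?_))
    have h1 := mem_prime_iff_norm_lt_one τ a
    have h2 := mem_prime_iff_norm_lt_one τ' a
    rw [hτ] at h1
    rw [hτ'] at h2
    exact h1.trans h2.symm
  have hττ : (τ : P.Completion → PadicAlgCl p) = τ' :=
    (P.prime.denseRange_algebraMap k).equalizer (continuous_embedding τ) (continuous_embedding τ')
      (funext fun x => (hτ x).trans (hτ' x).symm)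
  have : ρ = ρ' := AlgHom.ext fun y => by rw [← hρ, ← hρ', hττ]
  rw [this]

theorem norm_unramifiedEmb_le_one {P : PrimesAbove p k} (ρ : P.UnramifiedEmb) {y : P.l}
    (hy : Valued.v (y : P.Completion) ≤ 1) : ‖ρ y‖ ≤ 1 := by
  -- ρ extends to k_𝔭 because the target is algebraically closed, so the bound for embeddings of k_𝔭
  -- applies.
  obtain ⟨τ, hτ⟩ := IsAlgClosed.surjective_domRestrict_of_isAlgebraic (K := ℚ_[p])
    (M := PadicAlgCl p) (L := P.l) (E := P.Completion) ρ
  rw [← hτ]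
  exact norm_embedding_le_one τ hy

theorem norm_le_one_of_isIntegral {K : Type*} [NormedField K] [IsUltrametricDist K] {x : K}
    (hx : IsIntegral ℤ x) : ‖x‖ ≤ 1 :=
  (Valuation.integer.integers (NormedField.valuation (K := K))).mem_of_integral hx.tower_top

/-- The exponents of `p` in a product over all rows, grouped by classes. -/
theorem two_mul_sum_weight {κ : Type*} [Fintype κ] [DecidableEq κ] {n : ℕ} (c : Fin n → κ)
    (w v : κ → ℝ) :
    2 * ∑ i, w (c i) * (v (c i) + (Finset.univ.filter fun t => t < i ∧ c t = c i).card) =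
      ∑ K, w K * ((Finset.univ.filter fun i => c i = K).card *
        (2 * v K + (Finset.univ.filter fun i => c i = K).card - 1)) := by
  rw [← Finset.sum_fiberwise Finset.univ c, Finset.mul_sum]
  refine Finset.sum_congr rfl fun K _ => ?_
  have h : ∀ i ∈ Finset.univ.filter fun i => c i = K,
      w (c i) * (v (c i) + (Finset.univ.filter fun t => t < i ∧ c t = c i).card) =
      w K * v K + w K * (((Finset.univ.filter fun t => c t = K).filter (· < i)).card : ℝ) := by
    intro i hi
    obtain rfl := (Finset.mem_filter.mp hi).2
    rw [Finset.filter_filter, mul_add]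
    simp only [and_comm]
  have hT := sum_card_filter_lt (Finset.univ.filter fun i => c i = K)
  rw [Finset.sum_congr rfl h, Finset.sum_add_distrib, Finset.sum_const, ← Finset.mul_sum,
    nsmul_eq_mul]
  linear_combination w K * hT

theorem le_vp_sq {x : PadicAlgCl p} {T : ℝ} (hx : ‖x‖ ≤ (p : ℝ) ^ (-T)) :
    ((2 * T : ℝ) : WithTop ℝ) ≤ vp p (x ^ 2) := by
  by_cases h0 : x = 0
  · simp [h0]
  have hp : (1 : ℝ) < p := by exact_mod_cast (Fact.out : p.Prime).one_lt
  rw [vp_of_ne_zero p (pow_ne_zero 2 h0), WithTop.coe_le_coe, norm_pow, Real.logb_pow]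
  have := (Real.logb_le_iff_le_rpow hp (norm_pos_iff.mpr h0)).mpr hx
  push_cast
  linarith

end Inertial

end InertialDet

/-! ### Assembly of the determinant bound -/

open WithZero Filter Topology in
/-- The determinant bound, for an enumeration of the embeddings and of the columns. -/
theorem InertialDet.norm_det_le {p : ℕ} [Fact p.Prime] {k : Type*} [Field k] [NumberField k]
    (ι : AlgebraicClosure ℚ →+* PadicAlgCl p) {𝔫 : Ideal (𝓞 k)} {n : ℕ}
    (σ : Fin n → k →+* AlgebraicClosure ℚ) (hσ : Function.Injective σ)
    (x : Fin n → 𝓞 k) (hx : ∀ j, x j ∈ 𝔫) :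
    ‖(Matrix.of fun i j => ι (σ i (x j))).det‖ ≤
      (p : ℝ) ^ (-((∑ P : PrimesAbove p k, 1 / (P.e : ℝ) * ∑ ρ : P.UnramifiedEmb,
        (Set.ncard (Set.range σ ∩ inertialClass ι P ρ) : ℝ) *
          (2 * (multiplicity P.prime.asIdeal 𝔫 : ℝ) +
            (Set.ncard (Set.range σ ∩ inertialClass ι P ρ) : ℝ) - 1)) / 2)) := by
  classical
  have hp : (1 : ℝ) < p := by exact_mod_cast (Fact.out : p.Prime).one_lt
  have hp0 : (0 : ℝ) < p := zero_lt_one.trans hp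
  -- The summand `Fin n` gives a row lying in no inertial class a class of its own, with weight 0.
  -- This avoids proving that the inertial classes cover all embeddings.
  let κ := (Σ P : PrimesAbove p k, P.UnramifiedEmb) ⊕ Fin n
  let M : Matrix (Fin n) (Fin n) (PadicAlgCl p) := Matrix.of fun i j => ι (σ i (x j))
  have hM1 : ∀ i j, ‖M i j‖ ≤ 1 := fun i j => norm_le_one_of_isIntegral
    ((x j).isIntegral_coe.map (ι.comp (σ i)).toIntAlgHom)
  have hc : ∀ i, ∃ K : κ, (∀ c, K = .inl c ↔ σ i ∈ inertialClass ι c.1 c.2) ∧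
      ∀ i', K = .inr i' → i' = i := fun i => by
    by_cases h : ∃ c : Σ P : PrimesAbove p k, P.UnramifiedEmb, σ i ∈ inertialClass ι c.1 c.2
    · obtain ⟨c, hc⟩ := h
      refine ⟨.inl c, fun c' => ⟨?_, fun hc' => ?_⟩, by simp⟩
      · rintro ⟨⟩
        exact hc
      · rw [eq_of_mem_inertialClass hc hc']
    · refine ⟨.inr i, fun c => ⟨by simp, fun hc => (h ⟨c, hc⟩).elim⟩, ?_⟩
      rintro i' ⟨⟩
      rfl
  choose c hc hc' using hc
  choose π hπ using fun P : PrimesAbove p k => P.exists_uniformizer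
  choose a ha hax using fun (P : PrimesAbove p k) j =>
    P.exists_expansion (hπ P) _ _ (P.valued_le_of_mem (hx j))
  let A : ℕ → κ → Fin n → PadicAlgCl p := fun s K j => match K with
    | .inl c => c.2 (a c.1 j s)
    | .inr i => if s = 0 then M i j else 0
  let v : κ → ℕ := Sum.elim (fun c => multiplicity c.1.prime.asIdeal 𝔫) 0
  let w : κ → ℝ := Sum.elim (fun c => 1 / (c.1.e : ℝ)) 0
  have hw : ∀ K, 0 ≤ w K := by
    rintro (K | i)
    · exact div_nonneg zero_le_one (Nat.cast_nonneg _)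
    · exact le_rfl
  have hA : ∀ s K j, ‖A s K j‖ ≤ 1 := by
    rintro s (K | i) j
    · exact norm_unramifiedEmb_le_one _ (ha _ _ _)
    · by_cases hs : s = 0
      · simpa [A, hs] using hM1 i j
      · simp [A, hs]
  have hα : ∀ i, ∃ α : PadicAlgCl p, ‖α‖ ≤ (p : ℝ) ^ (-w (c i)) ∧ ∀ j,
      Tendsto (fun N => α ^ v (c i) * ∑ s ∈ Finset.range N, A s (c i) j * α ^ s)
        atTop (𝓝 (M i j)) := fun i => by
    rcases hK : c i with K | i'
    · obtain ⟨τ, hτ, hρ⟩ := (hc i K).mp hK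
      refine ⟨τ (π K.1), norm_embedding_uniformizer_le τ (hπ K.1), fun j => ?_⟩
      have := ((continuous_embedding τ).tendsto _).comp (hax K.1 j)
      rw [hτ] at this
      refine this.congr fun N => ?_
      simp [v, A, hρ]
    · obtain rfl := hc' i i' hK
      refine ⟨0, by simp [w], fun j => ?_⟩
      -- At the point 0, with v = 0, only the constant coefficient M i' j survives once N > 0.
      refine (tendsto_const_nhds (x := M i' j)).congr' ?_
      filter_upwards [eventually_gt_atTop 0] with N hN
      rw [Finset.sum_eq_single_of_mem 0 (Finset.mem_range.mpr hN) (by simp +contextual)]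
      simp [A, v]
  choose α hα hlim using hα
  have hα1 : ∀ i, ‖α i‖ ≤ 1 := fun i => (hα i).trans
    (Real.rpow_le_one_of_one_le_of_nonpos hp.le (neg_nonpos.mpr (hw _)))
  refine (norm_det_le_of_tendsto c α hα1 A hA v M hlim).trans ?_
  have hrow : ∀ i, ‖α i‖ ^ v (c i) * ∏ t with t < i ∧ c t = c i, ‖α i - α t‖ ≤
      (p : ℝ) ^ (-(w (c i) * ((v (c i) : ℝ) +
        (Finset.univ.filter fun t => t < i ∧ c t = c i).card))) := fun i => by
    have h1 : ∏ t with t < i ∧ c t = c i, ‖α i - α t‖ ≤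
        ((p : ℝ) ^ (-w (c i))) ^ (Finset.univ.filter fun t => t < i ∧ c t = c i).card := by
      rw [← Finset.prod_const]
      -- Rows t and i share a class, hence the same weight, and the ultrametric inequality bounds
      -- their difference.
      refine Finset.prod_le_prod (fun _ _ => norm_nonneg _) fun t ht => ?_
      rw [sub_eq_add_neg]
      refine (IsUltrametricDist.norm_add_le_max _ _).trans (max_le (hα i) ?_)
      rw [norm_neg, ← (Finset.mem_filter.mp ht).2.2]
      exact hα t
    calc _ ≤ ((p : ℝ) ^ (-w (c i))) ^ v (c i) * ((p : ℝ) ^ (-w (c i))) ^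
          (Finset.univ.filter fun t => t < i ∧ c t = c i).card := by
          gcongr
          exact hα i
      _ = _ := by
        rw [← pow_add, ← Real.rpow_natCast, ← Real.rpow_mul hp0.le]
        push_cast
        ring_nf
  refine (Finset.prod_le_prod (fun i _ => by positivity) fun i _ => hrow i).trans_eq ?_
  rw [← Real.rpow_sum_of_pos hp0, Finset.sum_neg_distrib]
  congr 2
  rw [eq_div_iff two_ne_zero, mul_comm, two_mul_sum_weight c w (fun K => v K),
    Fintype.sum_sum_type, Fintype.sum_sigma]
  simp only [w, v, Sum.elim_inl, Sum.elim_inr, Pi.zero_apply, zero_mul, Finset.sum_const_zero,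
    add_zero, Finset.mul_sum]
  have hcard : ∀ (P : PrimesAbove p k) (ρ : P.UnramifiedEmb),
      (Finset.univ.filter fun i => c i = .inl ⟨P, ρ⟩).card =
        Set.ncard (Set.range σ ∩ inertialClass ι P ρ) := fun P ρ => by
    have : Set.range σ ∩ inertialClass ι P ρ =
        σ '' (Finset.univ.filter fun i => c i = .inl ⟨P, ρ⟩ : Finset (Fin n)) := by
      ext s
      simp only [Set.mem_inter_iff, Set.mem_range, Finset.coe_filter, Finset.mem_univ, true_and,
        Set.mem_image, Set.mem_ofPred_eq, hc]
      constructor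
      · rintro ⟨⟨i, rfl⟩, h⟩
        exact ⟨i, h, rfl⟩
      · rintro ⟨i, h, rfl⟩
        exact ⟨⟨i, rfl⟩, h⟩
    rw [this, Set.ncard_image_of_injective _ hσ, Set.ncard_coe_finset]
  simp only [hcard]

theorem mainTheorem9 (p : ℕ) [Fact p.Prime] (k : Type*) [Field k] [NumberField k]
    (ι : AlgebraicClosure ℚ →+* PadicAlgCl p)
    (𝔫 : Ideal (𝓞 k)) (h𝔫 : 𝔫 ≠ ⊥)
    (X : Finset (𝓞 k)) (hX : ∀ x ∈ X, x ∈ 𝔫)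
    (S : Finset (k →+* AlgebraicClosure ℚ)) (hSX : S.card = X.card) :
    ((∑ P : PrimesAbove p k, 1 / (P.e : ℝ) * ∑ ρ : P.UnramifiedEmb,
        (Set.ncard (↑S ∩ inertialClass ι P ρ) : ℝ) *
          (2 * (multiplicity P.prime.asIdeal 𝔫 : ℝ) +
            (Set.ncard (↑S ∩ inertialClass ι P ρ) : ℝ) - 1) : ℝ) : WithTop ℝ) ≤
      vp p (ι (detSq S X hSX)) := by
  let r : Fin S.card ≃ S := S.equivFin.symm
  let c : Fin S.card ≃ X := (finCongr hSX).trans X.equivFin.symm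
  have hr : Set.range (fun i => (r i : k →+* AlgebraicClosure ℚ)) = ↑S := by
    rw [show (fun i => (r i : k →+* AlgebraicClosure ℚ)) = Subtype.val ∘ r from rfl,
      r.surjective.range_comp, Subtype.range_coe]
  have h := norm_det_le (𝔫 := 𝔫) ι (fun i => (r i : k →+* AlgebraicClosure ℚ))
    (Subtype.val_injective.comp r.injective) (fun j => c j) fun j => hX _ (c j).2
  rw [hr] at h
  rw [detSq_eq S X hSX r c, map_pow, RingHom.map_det]
  exact le_of_eq_of_le (by rw [mul_div_cancel₀ _ two_ne_zero]) (le_vp_sq h)
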